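/- Let $0<q<1$ and $\alpha>-1$. Write $(a;q)_n=\prod_{k=0}^{n-1}(1-aq^k)$, $(a;q)_\infty=\prod_{k\ge 0}(1-aq^k)$, $[n]_q=\frac{1-q^n}{1-q}$, $[n]_q!=\prod_{k=1}^n[k]_q$. Let $$J^{(2)}_\alpha(z;q)=\frac{(q^{\alpha+1};q)_\infty}{(q;q)_\infty}\sum_{n=0}^\infty(-1)^n\frac{q^{n(n+\alpha)}(z/2)^{2n+\alpha}}{(q;q)_n(q^{\alpha+1};q)_n},\qquad \mathcal J^{(2)}_\alpha(z;q)=\sum_{n=0}^\infty(-1)^n\frac{q^{n(n+\alpha)}(z/2)^{2n}}{(q;q)_n(q^{\alpha+1};q)_n}$$ be Jackson's second $q$-Bessel function and its modified (entire) form, let $$E_q(z)=\sum_{n=0}^\infty\frac{q^{n(n-1)/2}}{(q;q)_n}(z(1-q))^n,\qquad Cos_q(z)=\frac{E_q(iz)+E_q(-iz)}{2},\qquad Sin_q(z)=\frac{E_q(iz)-E_q(-iz)}{2i},$$ and let the generalized $q$-Bernoulli polynomials $B^{(2)}_{n,\alpha}(z;q)$ be defined by the Taylor expansion at $t=0$ $$\frac{E_q(zt)\,E_q(-t/2)}{\mathcal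 J^{(2)}_\alpha(it(1-q);q^2)}=\sum_{n=0}^\infty B^{(2)}_{n,\alpha}(z;q)\frac{t^n}{[n]_q!}.$$ **Theorem 3.1.** The function $J^{(2)}_\alpha(\cdot;q^2)$ has a smallest positive zero $j^{(2)}_{1,\alpha}$, and $D:=\frac{d}{dw}\mathcal J^{(2)}_\alpha(w;q^2)\big|_{w=j^{(2)}_{1,\alpha}}\neq 0$. Put $\zeta:=\dfrac{j^{(2)}_{1,\alpha}}{2(1-q)}$. Then for every $z\in\mathbb C$ and every $r$ with $0<r\le 2\zeta$, as $n\to\infty$, $$B^{(2)}_{2n,\alpha}(z;q)=\frac{2}{1-q}\,\frac{(-1)^{n+1}[2n]_q!\,\bigl(Cos_q(2\zeta z)Cos_q(\zeta)+Sin_q(2\zeta z)Sin_q(\zeta)\bigr)}{(2\zeta)^{2n+1}D}+[2n]_q!\;o(r^{-2n}),$$ $$B^{(2)}_{2n+1,\alpha}(z;q)=\frac{2}{1-q}\,\frac{(-1)^{n+1}[2n+1]_q!\,\bigl(Sin_q(2\zeta z)Cos_q(\zeta)-Cos_q(2\zeta z)Sin_q(\zeta)\bigr)}{(2\zeta)^{2n+2}D}+[2n+1]_q!\;o(r^{-2n}).$$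 -/

import Mathlib

namespace QBernoulli

noncomputable section

/-- The finite `q`-shifted factorial `(a;q)_n = ∏_{k<n} (1 - a q^k)`. -/
def qPoch (a q : ℝ) (n : ℕ) : ℝ := ∏ k ∈ Finset.range n, (1 - a * q ^ k)

/-- The infinite `q`-shifted factorial `(a;q)_∞ = ∏_{k≥0} (1 - a q^k)`. -/
def qPochInf (a q : ℝ) : ℝ := ∏' k : ℕ, (1 - a * q ^ k)

/-- The `q`-number `[n]_q = (1 - q^n) / (1 - q)`. -/
def qNat (q : ℝ) (n : ℕ) : ℝ := (1 - q ^ n) / (1 - q)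

/-- The `q`-factorial `[n]_q! = [1]_q [2]_q ⋯ [n]_q`. -/
def qFact (q : ℝ) (n : ℕ) : ℝ := ∏ k ∈ Finset.range n, qNat q (k + 1)

/-- Jackson's second `q`-Bessel function
`J_α^{(2)}(z;q) = (q^{α+1};q)_∞ / (q;q)_∞ *
  ∑_n (-1)^n q^{n(α+n)} (z/2)^{2n+α} / ((q;q)_n (q^{α+1};q)_n)`
(principal branch of the power). -/
def jacksonBessel2 (α q : ℝ) (z : ℂ) : ℂ :=
  ((qPochInf (q ^ (α + 1)) q / qPochInf q q : ℝ) : ℂ) *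
    ∑' n : ℕ, (-1) ^ n * ((q ^ ((n : ℝ) * (α + n)) : ℝ) : ℂ) * (z / 2) ^ (2 * (n : ℂ) + (α : ℂ)) /
      ((qPoch q q n * qPoch (q ^ (α + 1)) q n : ℝ) : ℂ)

/-- The modified Jackson `q`-Bessel function `𝒥_α^{(2)}(z;q)`, as an entire function of `z`: it is
`(q;q)_∞ / (q^{α+1};q)_∞ * (z/2)^{-α} * J_α^{(2)}(z;q)` with the singularity at `0` removed
(see `modBessel2_eq`). -/
def modBessel2 (α q : ℝ) (z : ℂ) : ℂ :=
  ∑' n : ℕ, (-1) ^ n * ((q ^ ((n : ℝ) * (α + n)) : ℝ) : ℂ) * (z / 2) ^ (2 * n) /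
      ((qPoch q q n * qPoch (q ^ (α + 1)) q n : ℝ) : ℂ)

theorem qPochInf_ne_zero {a q : ℝ} (ha0 : 0 < a) (ha1 : a < 1) (hq0 : 0 < q) (hq1 : q < 1) :
    qPochInf a q ≠ 0 := by
  have h : ∀ k : ℕ, 1 + -(a * q ^ k) ≠ 0 := by
    intro k
    have h1 : q ^ k ≤ 1 := pow_le_one₀ hq0.le hq1.le
    have h2 : a * q ^ k ≤ a * 1 := mul_le_mul_of_nonneg_left h1 ha0.le
    linarith
  have hs : Summable fun k : ℕ => ‖-(a * q ^ k)‖ := by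
    have := (summable_geometric_of_lt_one hq0.le hq1).mul_left a
    refine this.congr fun k => ?_
    rw [norm_neg, Real.norm_of_nonneg (by positivity)]
  have := tprod_one_add_ne_zero_of_summable h hs
  simpa [qPochInf, sub_eq_add_neg] using this

/-- For `z ≠ 0` the modified function is the normalized Jackson `q`-Bessel function. -/
theorem modBessel2_eq {α q : ℝ} (hα : -1 < α) (hq0 : 0 < q) (hq1 : q < 1) {z : ℂ} (hz : z ≠ 0) :
    modBessel2 α q z = ((qPochInf q q / qPochInf (q ^ (α + 1)) q : ℝ) : ℂ) *
      (z / 2) ^ (-(α : ℂ)) * jacksonBessel2 α q z := by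
  have hz2 : z / 2 ≠ 0 := by simpa using hz
  have h1 : qPochInf q q ≠ 0 := qPochInf_ne_zero hq0 hq1 hq0 hq1
  have h2 : qPochInf (q ^ (α + 1)) q ≠ 0 :=
    qPochInf_ne_zero (Real.rpow_pos_of_pos hq0 _)
      (Real.rpow_lt_one hq0.le hq1 (by linarith)) hq0 hq1
  have h3 : ((qPochInf q q / qPochInf (q ^ (α + 1)) q : ℝ) : ℂ) *
      ((qPochInf (q ^ (α + 1)) q / qPochInf q q : ℝ) : ℂ) = 1 := by
    rw [← Complex.ofReal_mul, div_mul_div_comm, mul_comm, div_self (mul_ne_zero h2 h1),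
      Complex.ofReal_one]
  rw [jacksonBessel2, mul_mul_mul_comm, h3, one_mul, ← tsum_mul_left, modBessel2]
  refine tsum_congr fun n => ?_
  have h4 : (z / 2) ^ (2 * n) = (z / 2) ^ (-(α : ℂ)) * (z / 2) ^ (2 * (n : ℂ) + (α : ℂ)) := by
    rw [← Complex.cpow_add _ _ hz2, ← Complex.cpow_natCast]
    congr 1
    push_cast
    ring
  rw [h4]
  ring

/-- `j_{1,α}^{(2)}`: the smallest positive zero of `J_α^{(2)}(·;q²)`. -/
def firstZero (α q : ℝ) : ℝ := sInf {x : ℝ | 0 < x ∧ jacksonBessel2 α (q ^ 2) (x : ℂ) = 0}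

/-- `ζ_{α,1} = j_{1,α}^{(2)} / (2 (1 - q))`. -/
def zeta1 (α q : ℝ) : ℝ := firstZero α q / (2 * (1 - q))

/-- Jackson's `q`-exponential `E_q(z) = ∑_n q^{n(n-1)/2} (z(1-q))^n / (q;q)_n`. -/
def bigE (q : ℝ) (z : ℂ) : ℂ :=
  ∑' n : ℕ, ((q ^ (n * (n - 1) / 2) : ℝ) : ℂ) * (z * (1 - (q : ℂ))) ^ n / ((qPoch q q n : ℝ) : ℂ)

/-- `Cos_q`, the even part of `z ↦ E_q(iz)`. -/
def bigCos (q : ℝ) (z : ℂ) : ℂ := (bigE q (Complex.I * z) + bigE q (-(Complex.I * z))) / 2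

/-- `Sin_q`: `i Sin_q` is the odd part of `z ↦ E_q(iz)`. -/
def bigSin (q : ℝ) (z : ℂ) : ℂ :=
  (bigE q (Complex.I * z) - bigE q (-(Complex.I * z))) / (2 * Complex.I)

theorem bigE_I_mul (q : ℝ) (z : ℂ) :
    bigE q (Complex.I * z) = bigCos q z + Complex.I * bigSin q z := by
  have := Complex.I_ne_zero
  unfold bigCos bigSin
  field_simp
  ring

/-- `g_α^{(2)}(t;q) = 𝒥_α^{(2)}(t(1-q);q²)`. -/
def gFun (α q : ℝ) (t : ℂ) : ℂ := modBessel2 α (q ^ 2) (t * (1 - (q : ℂ)))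

/-- The generating function `E_q(zt) E_q(-t/2) / g_α^{(2)}(it;q)` of the polynomials. -/
def genFun (α q : ℝ) (z t : ℂ) : ℂ :=
  bigE q (z * t) * bigE q (-t / 2) / gFun α q (Complex.I * t)

/-- The generalized `q`-Bernoulli polynomial `B_{n,α}^{(2)}(z;q)`: the coefficient of
`t^n / [n]_q!` in the Taylor expansion of the generating function at `t = 0`. -/
def qBernoulli2 (α q : ℝ) (n : ℕ) (z : ℂ) : ℂ :=
  ((qFact q n : ℝ) : ℂ) * (iteratedDeriv n (genFun α q z) 0 / (n.factorial : ℂ))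

/-- `d/dw 𝒥_α^{(2)}(w;q²)` at `w = j_{1,α}^{(2)}`. -/
def modBesselDeriv (α q : ℝ) : ℂ := deriv (modBessel2 α (q ^ 2)) (firstZero α q : ℂ)

end

end QBernoulli

/-!
The generating function is meromorphic in `t`, with entire numerator and with denominator
`𝒥_α^{(2)}(it(1-q);q²)`, so its Taylor coefficients are asymptotically those of the principal
parts at the poles nearest to the origin (Darboux's method). It remains to see that these are
exactly `± 2iζ` and that they are simple. In the variable `x = (w/2)²`, the functions
`F_k(x) = 𝒥_{α+k}^{(2)}(w;q²)` tend to `1` as `k → ∞` and satisfy a three-term recurrence with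
positive coefficients. Running the Christoffel–Darboux identity backwards from `k = ∞` shows that
`Im (x F_{k+1}(x) conj (F_k(x))) > 0` in the upper half-plane, so that all zeros are real, and
that the numerator of the derivative of `x F_{k+1} / F_k` is positive for `x > 0`, so that
positive zeros are simple. If `F_k` had no positive zero, this monotonicity would make all later
`F_{k+j}` positive, against the recurrence.
-/

namespace QBernoulli

open Asymptotics ComplexConjugate Filter Topology

section PowerSeries

variable {c ρ : ℕ → ℂ}

theorem summable_norm_mul_pow_of_ratio_tendsto_zero (hρ : Tendsto ρ atTop (𝓝 0))
    (hc : ∀ n, c (n + 1) = ρ n * c n) (R : ℝ) : Summable fun n => ‖c n‖ * R ^ n := by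
  refine summable_of_ratio_norm_eventually_le one_half_lt_one ?_
  have hR : Tendsto (fun n => ‖ρ n‖ * |R|) atTop (𝓝 0) := by
    simpa using hρ.norm.mul_const |R|
  filter_upwards [hR.eventually_le_const one_half_pos] with n hn
  calc ‖‖c (n + 1)‖ * R ^ (n + 1)‖ = ‖ρ n‖ * |R| * ‖‖c n‖ * R ^ n‖ := by
        simp only [hc, norm_mul, norm_pow, pow_succ, Real.norm_eq_abs, abs_norm]
        ring
    _ ≤ 1 / 2 * ‖‖c n‖ * R ^ n‖ := by gcongr

theorem summable_mul_pow_of_ratio_tendsto_zero (hρ : Tendsto ρ atTop (𝓝 0))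
    (hc : ∀ n, c (n + 1) = ρ n * c n) (z : ℂ) : Summable fun n => c n * z ^ n :=
  .of_norm <| by simpa using summable_norm_mul_pow_of_ratio_tendsto_zero hρ hc ‖z‖

theorem differentiable_tsum_mul_pow_of_ratio_tendsto_zero (hρ : Tendsto ρ atTop (𝓝 0))
    (hc : ∀ n, c (n + 1) = ρ n * c n) : Differentiable ℂ fun z => ∑' n, c n * z ^ n := by
  set s := FormalMultilinearSeries.ofScalars ℂ c
  have hs : s.radius = ⊤ := s.radius_eq_top_of_summable_norm fun r => by
    simpa [s] using summable_norm_mul_pow_of_ratio_tendsto_zero hρ hc r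
  have hsum : s.sum = fun z => ∑' n, c n * z ^ n :=
    funext fun z => FormalMultilinearSeries.ofScalars_sum_eq c z
  have hd := (s.hasFPowerSeriesOnBall (hs ▸ ENNReal.zero_lt_top)).differentiableOn
  rwa [hs, Metric.eball_top, differentiableOn_univ, hsum] at hd

end PowerSeries

section Darboux

variable {N G H : ℂ → ℂ} {S : Finset ℂ} {U : Set ℂ}

theorem sub_mul_dslope (f : ℂ → ℂ) (a b : ℂ) : (b - a) * dslope f a b = f b - f a :=
  sub_smul_dslope f a b

theorem deriv_dslope_of_eq_zero {s u : ℂ} (hG : DifferentiableAt ℂ G u) (hus : u ≠ s)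
    (hs : G s = 0) (hu : G u = 0) : deriv (dslope G s) u = deriv G u / (u - s) := by
  have hus' : u - s ≠ 0 := sub_ne_zero.2 hus
  have hquot : dslope G s =ᶠ[𝓝 u] fun t => G t / (t - s) := by
    filter_upwards [isOpen_ne.mem_nhds hus] with t ht
    rw [eq_div_iff (sub_ne_zero.2 ht), mul_comm, sub_mul_dslope, hs, sub_zero]
  rw [hquot.deriv_eq, deriv_fun_div hG (by fun_prop) hus', hu]
  field_simp
  simp

/-- Induction on the number of poles: `dslope G s` divides the zero `s` out of `G`, and
`1 / ((t - u) * (t - s))` splits into simple fractions. -/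
theorem exists_differentiableOn_div_eq_add_sum_simple_poles (hU : IsOpen U)
    (hN : DifferentiableOn ℂ N U) (hG : DifferentiableOn ℂ G U)
    (hS : ∀ t, t ∈ S ↔ t ∈ U ∧ G t = 0) (hsimple : ∀ s ∈ S, deriv G s ≠ 0) :
    ∃ H, DifferentiableOn ℂ H U ∧
      ∀ t ∈ U, t ∉ S → N t / G t = H t + ∑ s ∈ S, N s / deriv G s / (t - s) := by
  induction S using Finset.induction_on generalizing G with
  | empty =>
    exact ⟨fun t => N t / G t, hN.div hG fun t ht h0 => absurd ((hS t).2 ⟨ht, h0⟩) (by simp),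
      by simp⟩
  | insert s S hsS ih =>
    obtain ⟨hsU, hGs⟩ := (hS s).1 (S.mem_insert_self s)
    have hUs : U ∈ 𝓝 s := hU.mem_nhds hsU
    have hne : ∀ u ∈ S, u ≠ s := fun u hu => ne_of_mem_of_not_mem hu hsS
    have hfactor : ∀ t, (t - s) * dslope G s t = G t := fun t => by
      rw [sub_mul_dslope, hGs, sub_zero]
    have hzeros : ∀ t, t ∈ S ↔ t ∈ U ∧ dslope G s t = 0 := fun t => by
      rcases eq_or_ne t s with rfl | hts
      · simp [hsS, dslope_same, hsimple t]
      · simpa [hts, ← hfactor t, sub_ne_zero.2 hts] using hS t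
    have hderiv : ∀ u ∈ S, deriv (dslope G s) u = deriv G u / (u - s) := fun u hu => by
      obtain ⟨huU, hGu⟩ := (hS u).1 (Finset.mem_insert_of_mem hu)
      exact deriv_dslope_of_eq_zero (hG.differentiableAt (hU.mem_nhds huU)) (hne u hu) hGs hGu
    obtain ⟨H, hH, hNH⟩ := ih ((Complex.differentiableOn_dslope hUs).2 hG) hzeros fun u hu => by
      rw [hderiv u hu]
      exact div_ne_zero (hsimple u (Finset.mem_insert_of_mem hu)) (sub_ne_zero.2 (hne u hu))
    refine ⟨dslope H s, (Complex.differentiableOn_dslope hUs).2 hH, fun t ht htS => ?_⟩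
    obtain ⟨hts, htS⟩ := not_or.1 (mt Finset.mem_insert.2 htS)
    have hts' : t - s ≠ 0 := sub_ne_zero.2 hts
    have hresidue : N s / deriv G s = H s - ∑ u ∈ S, N u / deriv G u := by
      rw [← dslope_same G s, hNH s hsU hsS, sub_eq_add_neg, ← Finset.sum_neg_distrib]
      refine congrArg _ (Finset.sum_congr rfl fun u hu => ?_)
      have := sub_ne_zero.2 (hne u hu)
      rw [hderiv u hu, ← neg_sub u s]
      field_simp
    have hsplit : (t - s) * ∑ u ∈ S, N u / deriv G u / (t - u) =
        ∑ u ∈ S, N u / deriv G u + ∑ u ∈ S, N u / deriv (dslope G s) u / (t - u) := by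
      rw [Finset.mul_sum, ← Finset.sum_add_distrib]
      refine Finset.sum_congr rfl fun u hu => ?_
      have := sub_ne_zero.2 (hne u hu)
      have := sub_ne_zero.2 (ne_of_mem_of_not_mem hu htS).symm
      rw [hderiv u hu]
      field_simp
      ring
    rw [Finset.sum_insert hsS, ← hfactor t, ← div_div, div_right_comm, hNH t ht htS,
      div_eq_iff hts', add_mul, mul_comm, sub_mul_dslope, add_mul, div_mul_cancel₀ _ hts',
      mul_comm _ (t - s), hsplit, hresidue]
    ring

/-- The `n`-th Taylor coefficient of `f` at the origin. -/
noncomputable def taylorCoeff (f : ℂ → ℂ) (n : ℕ) : ℂ := iteratedDeriv n f 0 / n.factorial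

theorem taylorCoeff_isLittleO {R r : ℝ} (hH : DifferentiableOn ℂ H (Metric.ball 0 R))
    (hr : 0 < r) (hrR : r < R) : taylorCoeff H =o[atTop] fun n => (r ^ n)⁻¹ := by
  have hmem : (r : ℂ) ∈ Metric.ball 0 R := by simpa [abs_of_pos hr] using hrR
  have hterm := (Complex.hasSum_taylorSeries_on_ball hH hmem).summable.tendsto_atTop_zero.norm
  rw [norm_zero] at hterm
  refine .of_norm_left <|
    (isLittleO_iff_tendsto fun n h => absurd h (by positivity)).2 (hterm.congr fun n => ?_)
  simp [taylorCoeff, abs_of_pos hr, div_eq_mul_inv, mul_comm, mul_left_comm]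

theorem taylorCoeff_inv_sub (s : ℂ) (n : ℕ) :
    taylorCoeff (fun t => (t - s)⁻¹) n = -(s ^ (n + 1))⁻¹ := by
  have h := congrFun (iter_deriv_inv_linear_sub n 1 s) 0
  simp only [one_mul, one_pow, mul_one, zero_sub] at h
  have hn : (n.factorial : ℂ) ≠ 0 := Nat.cast_ne_zero.2 n.factorial_ne_zero
  have hsign : (-1 : ℂ) ^ n * (-1) ^ n = 1 := by rw [← mul_pow]; simp
  rw [taylorCoeff, iteratedDeriv_eq_iterate, h, div_eq_iff hn,
    show (-1 - n : ℤ) = -((n + 1 : ℕ) : ℤ) by push_cast; ring, zpow_neg, zpow_natCast, neg_pow s,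
    mul_inv, ← inv_pow, inv_neg, inv_one, pow_succ (-1 : ℂ) n]
  linear_combination (-(n.factorial : ℂ) * (s ^ (n + 1))⁻¹) * hsign

/-- Darboux's method: the Taylor coefficients are governed by the poles. -/
theorem taylorCoeff_div_isLittleO {R r : ℝ} (hN : DifferentiableOn ℂ N (Metric.ball 0 R))
    (hG : DifferentiableOn ℂ G (Metric.ball 0 R)) (hG0 : G 0 ≠ 0)
    (hS : ∀ t, t ∈ S ↔ t ∈ Metric.ball 0 R ∧ G t = 0) (hsimple : ∀ s ∈ S, deriv G s ≠ 0)
    (hr : 0 < r) (hrR : r < R) :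
    (fun n => taylorCoeff (fun t => N t / G t) n + ∑ s ∈ S, N s / deriv G s / s ^ (n + 1))
      =o[atTop] fun n => (r ^ n)⁻¹ := by
  obtain ⟨H, hH, hNG⟩ :=
    exists_differentiableOn_div_eq_add_sum_simple_poles Metric.isOpen_ball hN hG hS hsimple
  refine (taylorCoeff_isLittleO hH hr hrR).congr_left fun n => ?_
  have hball : Metric.ball (0 : ℂ) R ∈ 𝓝 0 := Metric.ball_mem_nhds 0 (hr.trans hrR)
  have hS0 : ∀ s ∈ S, (0 : ℂ) - s ≠ 0 := fun s hs => by
    rw [zero_sub, neg_ne_zero]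
    exact fun h0 => hG0 (h0 ▸ ((hS s).1 hs).2)
  have hnear : (fun t => N t / G t) =ᶠ[𝓝 0]
      fun t => H t + ∑ s ∈ S, N s / deriv G s * (t - s)⁻¹ := by
    have hGcont := (hG.differentiableAt hball).continuousAt
    filter_upwards [hball, hGcont.eventually_ne hG0] with t ht hGt
    simpa only [div_eq_mul_inv] using hNG t ht fun htS => hGt ((hS t).1 htS).2
  have hHn : ContDiffAt ℂ n H 0 := (hH.analyticAt hball).contDiffAt
  have hpole : ∀ s ∈ S, ContDiffAt ℂ n (fun t => N s / deriv G s * (t - s)⁻¹) 0 := fun s hs =>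
    contDiffAt_const.mul ((contDiffAt_id.sub contDiffAt_const).inv (hS0 s hs))
  have hcoeff : ∀ s, iteratedDeriv n (fun t => N s / deriv G s * (t - s)⁻¹) 0 / n.factorial =
      -(N s / deriv G s / s ^ (n + 1)) := fun s => by
    rw [iteratedDeriv_const_mul_field, mul_div_assoc, ← taylorCoeff, taylorCoeff_inv_sub,
      mul_neg, ← div_eq_mul_inv]
  rw [taylorCoeff, taylorCoeff, hnear.iteratedDeriv_eq,
    iteratedDeriv_fun_add hHn (ContDiffAt.sum hpole), iteratedDeriv_fun_sum hpole, add_div,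
    Finset.sum_div, Finset.sum_congr rfl fun s _ => hcoeff s, Finset.sum_neg_distrib,
    neg_add_cancel_right]

end Darboux

section LommelChain

theorem forall_of_eventually_of_backward_step {P : ℕ → Prop} (hP : ∀ᶠ k in atTop, P k)
    (hstep : ∀ k, P (k + 1) → P (k + 2) → P k) (k : ℕ) : P k := by
  obtain ⟨N, hN⟩ := eventually_atTop.1 hP
  have hback : ∀ m k, N ≤ k + m → P k := fun m => by
    induction m with
    | zero => exact hN
    | succ m ih => exact fun k hk => hstep k (ih _ (by lia)) (ih _ (by lia))
  exact hback N k (Nat.le_add_left N k)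

theorem christoffel_darboux_step {A : Type*} [CommRing A] {u v a : ℕ → A} {x y : A}
    (hu : ∀ k, u k = u (k + 1) - a k * x * u (k + 2))
    (hv : ∀ k, v k = v (k + 1) - a k * y * v (k + 2)) (k : ℕ) :
    x * u (k + 1) * v k - y * v (k + 1) * u k =
      (x - y) * u (k + 1) * v (k + 1) +
        a k * a (k + 1) * x * y * (x * u (k + 3) * v (k + 2) - y * v (k + 3) * u (k + 2)) := by
  linear_combination x * u (k + 1) * hv k - y * v (k + 1) * hu k -
    a k * x * y * v (k + 2) * hu (k + 1) + a k * x * y * u (k + 2) * hv (k + 1)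

/-- A Lommel chain: a sequence of entire functions, real on the real axis, that tends to `1` and
satisfies the three-term recurrence `F k = F (k + 1) - a k * x * F (k + 2)` of Lommel polynomials
with positive coefficients. For Bessel functions `k` shifts the order, and `x` is the square of
the usual variable up to a constant. -/
structure IsLommelChain (a : ℕ → ℝ) (F : ℕ → ℂ → ℂ) : Prop where
  coeff_pos : ∀ k, 0 < a k
  differentiable : ∀ k, Differentiable ℂ (F k)
  conj_apply : ∀ k x, conj (F k x) = F k (conj x)
  recurrence : ∀ k x, F k x = F (k + 1) x - a k * x * F (k + 2) x
  tendsto_one : TendstoLocallyUniformly F (fun _ => 1) atTop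

/-- The restriction of `F k` to the real axis, as a real function; meaningful when `F k` is real
there. -/
noncomputable def realAxis (F : ℕ → ℂ → ℂ) (k : ℕ) (x : ℝ) : ℝ := (F k x).re

/-- The confluent Christoffel–Darboux kernel of `F (k + 1)` and `F k` on the real axis. It is the
numerator of the derivative of `x * F (k + 1) x / F k x`. -/
noncomputable def confluentKernel (F : ℕ → ℂ → ℂ) (k : ℕ) (x : ℝ) : ℝ :=
  (realAxis F (k + 1) x + x * deriv (realAxis F (k + 1)) x) * realAxis F k x -
    x * realAxis F (k + 1) x * deriv (realAxis F k) x

namespace IsLommelChain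

variable {a : ℕ → ℝ} {F : ℕ → ℂ → ℂ}

theorem tendsto_apply (h : IsLommelChain a F) (x : ℂ) : Tendsto (F · x) atTop (𝓝 1) :=
  (tendstoLocallyUniformlyOn_univ.2 h.tendsto_one).tendsto_at (Set.mem_univ x)

theorem tendsto_deriv (h : IsLommelChain a F) (x : ℂ) :
    Tendsto (fun k => deriv (F k) x) atTop (𝓝 0) := by
  simpa [Function.comp_def] using
    ((tendstoLocallyUniformlyOn_univ.2 h.tendsto_one).deriv
      (.of_forall fun k => (h.differentiable k).differentiableOn) isOpen_univ).tendsto_at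
        (Set.mem_univ x)

theorem apply_zero (h : IsLommelChain a F) (k : ℕ) : F k 0 = 1 := by
  have hconst : ∀ n, F (k + n) 0 = F k 0 := fun n => by
    induction n with
    | zero => rfl
    | succ n ih => simpa [← add_assoc, ih] using (h.recurrence (k + n) 0).symm
  refine tendsto_nhds_unique ?_ ((tendsto_add_atTop_iff_nat k).2 (h.tendsto_apply 0))
  simpa only [add_comm _ k, hconst] using tendsto_const_nhds

theorem ofReal_realAxis (h : IsLommelChain a F) (k : ℕ) (x : ℝ) : (realAxis F k x : ℂ) = F k x :=
  Complex.conj_eq_iff_re.1 (by rw [h.conj_apply, Complex.conj_ofReal])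

theorem apply_ofReal_eq_zero_iff (h : IsLommelChain a F) {k : ℕ} {x : ℝ} :
    F k x = 0 ↔ realAxis F k x = 0 := by
  rw [← h.ofReal_realAxis, Complex.ofReal_eq_zero]

theorem realAxis_zero (h : IsLommelChain a F) (k : ℕ) : realAxis F k 0 = 1 := by
  simp [realAxis, h.apply_zero]

theorem realAxis_recurrence (h : IsLommelChain a F) (k : ℕ) (x : ℝ) :
    realAxis F k x = realAxis F (k + 1) x - a k * x * realAxis F (k + 2) x := by
  have := h.recurrence k x
  simp only [← h.ofReal_realAxis] at this
  exact_mod_cast this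

theorem tendsto_realAxis (h : IsLommelChain a F) (x : ℝ) : Tendsto (realAxis F · x) atTop (𝓝 1) :=
  (Complex.continuous_re.tendsto 1).comp (h.tendsto_apply x)

theorem hasDerivAt_realAxis (h : IsLommelChain a F) (k : ℕ) (x : ℝ) :
    HasDerivAt (realAxis F k) (deriv (F k) x).re x :=
  (h.differentiable k x).hasDerivAt.real_of_complex

theorem differentiable_realAxis (h : IsLommelChain a F) (k : ℕ) :
    Differentiable ℝ (realAxis F k) := fun x => (h.hasDerivAt_realAxis k x).differentiableAt

theorem tendsto_deriv_realAxis (h : IsLommelChain a F) (x : ℝ) :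
    Tendsto (fun k => deriv (realAxis F k) x) atTop (𝓝 0) :=
  ((Complex.continuous_re.tendsto 0).comp (h.tendsto_deriv x)).congr fun k =>
    (h.hasDerivAt_realAxis k x).deriv.symm

theorem deriv_realAxis_recurrence (h : IsLommelChain a F) (k : ℕ) (x : ℝ) :
    deriv (realAxis F k) x = deriv (realAxis F (k + 1)) x -
      a k * (realAxis F (k + 2) x + x * deriv (realAxis F (k + 2)) x) := by
  have hd := fun k => (h.differentiable_realAxis k x).hasDerivAt
  have := (hd (k + 1)).fun_sub (((hasDerivAt_id' x).const_mul (a k)).fun_mul (hd (k + 2)))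
  rw [funext (h.realAxis_recurrence k), this.deriv]
  ring

theorem im_christoffel_darboux (h : IsLommelChain a F) (k : ℕ) (x : ℂ) :
    (x * F (k + 1) x * conj (F k x)).im = x.im * Complex.normSq (F (k + 1) x) +
      a k * a (k + 1) * Complex.normSq x * (x * F (k + 3) x * conj (F (k + 2) x)).im := by
  have hCD := congrArg Complex.im <|
    christoffel_darboux_step (h.recurrence · x) (h.recurrence · (conj x)) k
  simp only [← h.conj_apply] at hCD
  simp only [Complex.normSq_apply, Complex.add_im, Complex.sub_im, Complex.sub_re, Complex.mul_im,
    Complex.mul_re, Complex.conj_im, Complex.conj_re, Complex.ofReal_re, Complex.ofReal_im,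
    sub_self, zero_mul, mul_zero, zero_add, sub_zero] at hCD ⊢
  linear_combination hCD / 2

theorem apply_ne_zero_of_im_pos (h : IsLommelChain a F) {x : ℂ} (hx : 0 < x.im) (k : ℕ) :
    F k x ≠ 0 := by
  have hpos : 0 < (x * F (k + 1) x * conj (F k x)).im := by
    refine forall_of_eventually_of_backward_step
      (P := fun k => 0 < (x * F (k + 1) x * conj (F k x)).im) ?_ (fun k _ hk => ?_) k
    · have hF := h.tendsto_apply x
      have hlim := ((tendsto_add_atTop_iff_nat 1).2 hF |>.const_mul x).mul
        ((Complex.continuous_conj.tendsto 1).comp hF)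
      exact ((Complex.continuous_im.tendsto _).comp hlim).eventually (lt_mem_nhds (by simpa))
    · have hx0 : 0 < Complex.normSq x := Complex.normSq_pos.2 fun h0 => by simp [h0] at hx
      have ha := mul_pos (h.coeff_pos k) (h.coeff_pos (k + 1))
      rw [h.im_christoffel_darboux]
      exact add_pos_of_nonneg_of_pos (mul_nonneg hx.le (Complex.normSq_nonneg _))
        (mul_pos (mul_pos ha hx0) hk)
  intro h0
  simp [h0] at hpos

theorem im_eq_zero_of_apply_eq_zero (h : IsLommelChain a F) {k : ℕ} {x : ℂ} (hx : F k x = 0) :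
    x.im = 0 := by
  rcases lt_trichotomy x.im 0 with him | him | him
  · refine absurd ?_ (h.apply_ne_zero_of_im_pos (x := conj x) (by simpa using him) k)
    rw [← h.conj_apply, hx, map_zero]
  · exact him
  · exact absurd hx (h.apply_ne_zero_of_im_pos him k)

theorem realAxis_pos_of_nonpos (h : IsLommelChain a F) {x : ℝ} (hx : x ≤ 0) (k : ℕ) :
    0 < realAxis F k x := by
  refine forall_of_eventually_of_backward_step (P := fun k => 0 < realAxis F k x)
    ((h.tendsto_realAxis x).eventually (lt_mem_nhds one_pos)) (fun k h₁ h₂ => ?_) k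
  rw [h.realAxis_recurrence, sub_eq_add_neg, ← neg_mul, ← mul_neg]
  exact add_pos_of_pos_of_nonneg h₁
    (mul_nonneg (mul_nonneg (h.coeff_pos k).le (neg_nonneg.2 hx)) h₂.le)

theorem exists_pos_of_apply_eq_zero (h : IsLommelChain a F) {k : ℕ} {x : ℂ} (hx : F k x = 0) :
    ∃ y : ℝ, 0 < y ∧ x = y := by
  have hre : x = x.re := Complex.ext rfl (h.im_eq_zero_of_apply_eq_zero hx)
  rw [hre, h.apply_ofReal_eq_zero_iff] at hx
  exact ⟨x.re, not_le.1 fun hle => (h.realAxis_pos_of_nonpos hle k).ne' hx, hre⟩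

theorem confluentKernel_recurrence (h : IsLommelChain a F) (k : ℕ) (x : ℝ) :
    confluentKernel F k x =
      realAxis F (k + 1) x ^ 2 + a k * a (k + 1) * x ^ 2 * confluentKernel F (k + 2) x := by
  unfold confluentKernel
  rw [h.deriv_realAxis_recurrence k, h.realAxis_recurrence k]
  linear_combination
    a k * x ^ 2 * deriv (realAxis F (k + 2)) x * h.realAxis_recurrence (k + 1) x -
      a k * x ^ 2 * realAxis F (k + 2) x * h.deriv_realAxis_recurrence (k + 1) x

theorem confluentKernel_pos (h : IsLommelChain a F) {x : ℝ} (hx : 0 < x) (k : ℕ) :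
    0 < confluentKernel F k x := by
  refine forall_of_eventually_of_backward_step (P := fun k => 0 < confluentKernel F k x)
    ?_ (fun k _ hk => ?_) k
  · have hF := h.tendsto_realAxis x
    have hF' := h.tendsto_deriv_realAxis x
    have hF₁ := (tendsto_add_atTop_iff_nat 1).2 hF
    have hlim := ((hF₁.add (((tendsto_add_atTop_iff_nat 1).2 hF').const_mul x)).mul hF).sub
      ((hF₁.const_mul x).mul hF')
    exact hlim.eventually (lt_mem_nhds (by norm_num))
  · have ha := h.coeff_pos k
    have ha' := h.coeff_pos (k + 1)
    rw [h.confluentKernel_recurrence]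
    positivity

theorem deriv_realAxis_ne_zero (h : IsLommelChain a F) {k : ℕ} {x : ℝ} (hx : 0 < x)
    (hx0 : realAxis F k x = 0) : deriv (realAxis F k) x ≠ 0 := fun hd => by
  simpa [confluentKernel, hx0, hd] using h.confluentKernel_pos hx k

theorem realAxis_succ_pos (h : IsLommelChain a F) {k : ℕ} (hk : ∀ x, 0 < x → 0 < realAxis F k x)
    (x : ℝ) (hx : 0 < x) : 0 < realAxis F (k + 1) x := by
  have hk' : ∀ y, 0 ≤ y → realAxis F k y ≠ 0 := fun y hy => hy.eq_or_lt.elim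
    (fun h0 => by simp [← h0, h.realAxis_zero]) fun hy => (hk y hy).ne'
  have hF := h.differentiable_realAxis
  have hmono : StrictMonoOn (fun y => y * realAxis F (k + 1) y / realAxis F k y) (Set.Ici 0) := by
    refine strictMonoOn_of_deriv_pos (convex_Ici 0) ?_ fun y hy => ?_
    · exact (continuous_id.mul (hF (k + 1)).continuous).continuousOn.div
        (hF k).continuous.continuousOn hk'
    · rw [interior_Ici, Set.mem_Ioi] at hy
      have hd := ((hasDerivAt_id' y).fun_mul (hF (k + 1) y).hasDerivAt).fun_div
        (hF k y).hasDerivAt (hk y hy).ne'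
      rw [hd.deriv, one_mul]
      exact div_pos (h.confluentKernel_pos hy k) (pow_pos (hk y hy) 2)
  have hquot := hmono Set.self_mem_Ici hx.le hx
  simp only [zero_mul, zero_div] at hquot
  exact pos_of_mul_pos_right ((div_pos_iff_of_pos_right (hk x hx)).1 hquot) hx.le

/-- If some `F k` were positive on `(0, ∞)`, then so would be all later ones; but the recurrence
makes `F k (1 / a k)` a negative multiple of `F (k + 3) (1 / a k)`. -/
theorem exists_pos_realAxis_eq_zero (h : IsLommelChain a F) (k : ℕ) :
    ∃ x, 0 < x ∧ realAxis F k x = 0 := by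
  by_contra! hne
  have hpos : ∀ x, 0 < x → 0 < realAxis F k x := fun x hx => by
    by_contra! hle
    obtain ⟨y, -, hy0⟩ := intermediate_value_Icc' hx.le
      (h.differentiable_realAxis k).continuous.continuousOn
      ⟨hle, (h.realAxis_pos_of_nonpos le_rfl k).le⟩
    exact hne y (not_le.1 fun hle => (h.realAxis_pos_of_nonpos hle k).ne' hy0) hy0
  have hpos₃ := h.realAxis_succ_pos (h.realAxis_succ_pos (h.realAxis_succ_pos hpos))
  have hx : 0 < (a k)⁻¹ := inv_pos.2 (h.coeff_pos k)
  have h₀ := h.realAxis_recurrence k (a k)⁻¹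
  rw [mul_inv_cancel₀ (h.coeff_pos k).ne', one_mul, h.realAxis_recurrence (k + 1)] at h₀
  have := mul_pos (mul_pos (h.coeff_pos (k + 1)) hx) (hpos₃ _ hx)
  linarith [hpos _ hx]

theorem exists_isLeast_zero (h : IsLommelChain a F) (k : ℕ) :
    ∃ y, IsLeast {x : ℝ | 0 < x ∧ F k x = 0} y := by
  obtain ⟨x, hx, hx0⟩ := h.exists_pos_realAxis_eq_zero k
  have heq : {x : ℝ | 0 < x ∧ F k x = 0} = Set.Ici 0 ∩ realAxis F k ⁻¹' {0} := by
    ext y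
    simp only [h.apply_ofReal_eq_zero_iff]
    exact ⟨fun hy => ⟨hy.1.le, hy.2⟩, fun hy =>
      ⟨not_le.1 fun hle => (h.realAxis_pos_of_nonpos hle k).ne' hy.2, hy.2⟩⟩
  rw [heq]
  exact ⟨_, (isClosed_Ici.inter (isClosed_singleton.preimage
    (h.differentiable_realAxis k).continuous)).isLeast_csInf ⟨x, hx.le, hx0⟩ ⟨0, fun _ hy => hy.1⟩⟩

theorem deriv_ne_zero (h : IsLommelChain a F) {k : ℕ} {y : ℝ} (hy : 0 < y) (hy0 : F k y = 0) :
    deriv (F k) y ≠ 0 :=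
  fun hd => h.deriv_realAxis_ne_zero hy (h.apply_ofReal_eq_zero_iff.1 hy0) <| by
    rw [(h.hasDerivAt_realAxis k y).deriv, hd, Complex.zero_re]

theorem exists_forall_norm_lt_eq_of_isLeast (h : IsLommelChain a F) {k : ℕ} {y : ℝ}
    (hy : IsLeast {x : ℝ | 0 < x ∧ F k x = 0} y) :
    ∃ R > y, ∀ x : ℂ, ‖x‖ < R → F k x = 0 → x = y := by
  have hd := (h.differentiable_realAxis k y).hasDerivAt.eventually_ne (c := 0)
    (h.deriv_realAxis_ne_zero hy.1.1 (h.apply_ofReal_eq_zero_iff.1 hy.1.2))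
  obtain ⟨R, hR, hIoo⟩ := mem_nhdsGT_iff_exists_Ioo_subset.1
    (hd.filter_mono (nhdsWithin_mono y fun x hx => ne_of_gt hx))
  refine ⟨R, hR, fun x hxR hx0 => ?_⟩
  obtain ⟨t, ht, rfl⟩ := h.exists_pos_of_apply_eq_zero hx0
  rw [Complex.norm_real, Real.norm_of_nonneg ht.le] at hxR
  rcases (hy.2 ⟨ht, hx0⟩).eq_or_lt with hyt | hyt
  · rw [hyt]
  · exact absurd (h.apply_ofReal_eq_zero_iff.1 hx0) (hIoo ⟨hyt, hxR⟩)

end IsLommelChain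

end LommelChain

section BesselSeries

variable {a b p q : ℝ}

theorem qPoch_succ (a p : ℝ) (n : ℕ) : qPoch a p (n + 1) = qPoch a p n * (1 - a * p ^ n) :=
  Finset.prod_range_succ _ _

theorem qPoch_mul_right (a p : ℝ) (n : ℕ) :
    (1 - a) * qPoch (a * p) p n = qPoch a p n * (1 - a * p ^ n) := by
  rw [← qPoch_succ, qPoch, qPoch, Finset.prod_range_succ', pow_zero, mul_one, mul_comm]
  exact congrArg (· * (1 - a)) (Finset.prod_congr rfl fun k _ => by ring)

theorem qPoch_ne_zero (ha : ∀ n, 1 - a * p ^ n ≠ 0) (n : ℕ) : qPoch a p n ≠ 0 :=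
  Finset.prod_ne_zero_iff.2 fun k _ => ha k

theorem one_sub_mul_pow_pos (ha0 : 0 ≤ a) (ha1 : a < 1) (hp0 : 0 ≤ p) (hp1 : p ≤ 1) (n : ℕ) :
    0 < 1 - a * p ^ n :=
  sub_pos.2 ((mul_le_of_le_one_right ha0 (pow_le_one₀ hp0 hp1)).trans_lt ha1)

theorem qPoch_pos (ha0 : 0 ≤ a) (ha1 : a < 1) (hp0 : 0 ≤ p) (hp1 : p ≤ 1) (n : ℕ) :
    0 < qPoch a p n :=
  Finset.prod_pos fun k _ => one_sub_mul_pow_pos ha0 ha1 hp0 hp1 k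

theorem qPoch_anti_left (hab : a ≤ b) (hb0 : 0 ≤ b) (hb1 : b < 1) (hp0 : 0 ≤ p) (hp1 : p ≤ 1)
    (n : ℕ) : qPoch b p n ≤ qPoch a p n :=
  Finset.prod_le_prod (fun k _ => (one_sub_mul_pow_pos hb0 hb1 hp0 hp1 k).le) fun k _ => by gcongr

/-- The coefficients of the modified Jackson `q`-Bessel function with base `p`, as a power series
in `x = (w / 2) ^ 2`; the parameter is `b = p ^ (α + 1)`. -/
noncomputable def besselCoeff (p b : ℝ) (n : ℕ) : ℝ :=
  (-1) ^ n * p ^ (n * (n - 1)) * b ^ n / (qPoch p p n * qPoch b p n)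

/-- The modified Jackson `q`-Bessel function with base `p` in the variable `x = (w / 2) ^ 2`; the
parameter is `b = p ^ (α + 1)`. -/
noncomputable def besselSeries (p b : ℝ) (x : ℂ) : ℂ := ∑' n, (besselCoeff p b n : ℂ) * x ^ n

theorem besselCoeff_zero (p b : ℝ) : besselCoeff p b 0 = 1 := by simp [besselCoeff, qPoch]

theorem besselCoeff_succ (p b : ℝ) (n : ℕ) : besselCoeff p b (n + 1) =
    -((p ^ n) ^ 2 * b / ((1 - p * p ^ n) * (1 - b * p ^ n))) * besselCoeff p b n := by
  have hexp : (n + 1) * (n + 1 - 1) = n * (n - 1) + n * 2 := by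
    cases n
    · rfl
    · simp only [Nat.add_sub_cancel]
      ring
  rw [besselCoeff, besselCoeff, qPoch_succ, qPoch_succ, hexp, pow_add p,
    pow_mul p n 2]
  simp only [div_eq_mul_inv, mul_inv]
  ring

theorem tendsto_besselCoeff_ratio (hp : |p| < 1) (b : ℝ) :
    Tendsto (fun n : ℕ => ((-((p ^ n) ^ 2 * b / ((1 - p * p ^ n) * (1 - b * p ^ n))) : ℝ) : ℂ))
      atTop (𝓝 0) := by
  have hpow := tendsto_pow_atTop_nhds_zero_of_abs_lt_one hp
  have hlim := (((hpow.pow 2).mul_const b).div (((hpow.const_mul p).const_sub 1).mul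
    ((hpow.const_mul b).const_sub 1)) (by simp)).neg
  exact (Complex.continuous_ofReal.tendsto' 0 0 Complex.ofReal_zero).comp (by simpa using hlim)

theorem ofReal_besselCoeff_succ (p b : ℝ) (n : ℕ) : (besselCoeff p b (n + 1) : ℂ) =
    ((-((p ^ n) ^ 2 * b / ((1 - p * p ^ n) * (1 - b * p ^ n))) : ℝ) : ℂ) * besselCoeff p b n := by
  rw [besselCoeff_succ, Complex.ofReal_mul]

theorem differentiable_besselSeries (hp : |p| < 1) (b : ℝ) : Differentiable ℂ (besselSeries p b) :=
  differentiable_tsum_mul_pow_of_ratio_tendsto_zero (tendsto_besselCoeff_ratio hp b)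
    (ofReal_besselCoeff_succ p b)

theorem summable_besselSeries (hp : |p| < 1) (b : ℝ) (x : ℂ) :
    Summable fun n => (besselCoeff p b n : ℂ) * x ^ n :=
  summable_mul_pow_of_ratio_tendsto_zero (tendsto_besselCoeff_ratio hp b)
    (ofReal_besselCoeff_succ p b) x

theorem summable_abs_besselCoeff_mul_pow (hp : |p| < 1) (b R : ℝ) :
    Summable fun n => |besselCoeff p b n| * R ^ n := by
  simpa using summable_norm_mul_pow_of_ratio_tendsto_zero
    (c := fun n => (besselCoeff p b n : ℂ)) (tendsto_besselCoeff_ratio hp b)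
    (ofReal_besselCoeff_succ p b) R

theorem conj_besselSeries (p b : ℝ) (x : ℂ) :
    conj (besselSeries p b x) = besselSeries p b (conj x) := by
  simp [besselSeries, Complex.conj_tsum]

theorem besselCoeff_contiguous (hp : ∀ n, 1 - p * p ^ n ≠ 0) (hb : ∀ n, 1 - b * p ^ n ≠ 0)
    (n : ℕ) : besselCoeff p b (n + 1) = besselCoeff p (b * p) (n + 1) -
      b / ((1 - b) * (1 - b * p)) * besselCoeff p (b * p ^ 2) n := by
  have hb₀ : 1 - b ≠ 0 := by simpa using hb 0
  have hb₁ : 1 - b * p ≠ 0 := by simpa using hb 1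
  have hshift : qPoch (b * p) p n = qPoch b p n * (1 - b * p ^ n) / (1 - b) := by
    rw [eq_div_iff hb₀, mul_comm, qPoch_mul_right]
  have hshift₂ : qPoch (b * p ^ 2) p n =
      qPoch b p n * (1 - b * p ^ n) / (1 - b) * (1 - b * p * p ^ n) / (1 - b * p) := by
    rw [eq_div_iff hb₁, ← hshift, ← qPoch_mul_right, mul_comm, mul_assoc b, sq]
  have hpn : 1 - p ^ n * p ≠ 0 := by simpa only [mul_comm] using hp n
  have hbn : 1 - p ^ n * b ≠ 0 := by simpa only [mul_comm] using hb n
  have hbn₁ : 1 - p ^ n * b * p ≠ 0 := by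
    simpa only [pow_succ, mul_comm, mul_left_comm] using hb (n + 1)
  have hPp := qPoch_ne_zero hp n
  have hPb := qPoch_ne_zero hb n
  rw [besselCoeff_succ, besselCoeff_succ, besselCoeff, besselCoeff, besselCoeff, hshift, hshift₂,
    mul_pow, mul_pow, pow_right_comm p 2 n]
  generalize p ^ n = t at *
  field_simp
  ring

theorem besselSeries_contiguous (hp : |p| < 1) (hb : ∀ n, 1 - b * p ^ n ≠ 0) (x : ℂ) :
    besselSeries p b x = besselSeries p (b * p) x -
      ((b / ((1 - b) * (1 - b * p)) : ℝ) : ℂ) * x * besselSeries p (b * p ^ 2) x := by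
  have hpp : ∀ n, 1 - p * p ^ n ≠ 0 := fun n h0 => by
    have := pow_lt_one₀ (abs_nonneg p) hp n.succ_ne_zero
    rw [← abs_pow, pow_succ', ← sub_eq_zero.1 h0, abs_one] at this
    exact lt_irrefl _ this
  have hs := summable_besselSeries hp (b * p) x
  rw [besselSeries, besselSeries, besselSeries, (summable_besselSeries hp b x).tsum_eq_zero_add,
    hs.tsum_eq_zero_add, ← tsum_mul_left, add_sub_assoc, ← ((summable_nat_add_iff 1).2 hs).tsum_sub
      ((summable_besselSeries hp (b * p ^ 2) x).mul_left _), besselCoeff_zero, besselCoeff_zero]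
  refine congrArg _ (tsum_congr fun n => ?_)
  rw [besselCoeff_contiguous hpp hb]
  push_cast
  ring

theorem abs_besselCoeff (hp0 : 0 ≤ p) (hp1 : p < 1) (hb0 : 0 ≤ b) (hb1 : b < 1) (n : ℕ) :
    |besselCoeff p b n| = p ^ (n * (n - 1)) * b ^ n / (qPoch p p n * qPoch b p n) := by
  have hPp := qPoch_pos hp0 hp1 hp0 hp1.le n
  have hPb := qPoch_pos hb0 hb1 hp0 hp1.le n
  rw [besselCoeff, mul_assoc, mul_div_assoc, abs_mul, abs_neg_one_pow, one_mul,
    abs_of_nonneg (by positivity)]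

theorem abs_besselCoeff_mul_pow_le (hp0 : 0 ≤ p) (hp1 : p < 1) (hb0 : 0 ≤ b) (hb1 : b < 1)
    (k n : ℕ) :
    |besselCoeff p (b * p ^ k) (n + 1)| ≤ p ^ k * |besselCoeff p b (n + 1)| := by
  have hk0 : 0 ≤ p ^ k := pow_nonneg hp0 k
  have hk1 : p ^ k ≤ 1 := pow_le_one₀ hp0 hp1.le
  have hbk : b * p ^ k ≤ b := mul_le_of_le_one_right hb0 hk1
  have hPp := qPoch_pos hp0 hp1 hp0 hp1.le (n + 1)
  have hPb := qPoch_pos hb0 hb1 hp0 hp1.le (n + 1)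
  have hanti := qPoch_anti_left hbk hb0 hb1 hp0 hp1.le (n + 1)
  have hpow : (p ^ k) ^ (n + 1) ≤ p ^ k := pow_le_of_le_one hk0 hk1 n.succ_ne_zero
  rw [abs_besselCoeff hp0 hp1 hb0 hb1,
    abs_besselCoeff hp0 hp1 (mul_nonneg hb0 hk0) (hbk.trans_lt hb1), ← mul_div_assoc]
  gcongr ?_ / (_ * ?_)
  calc p ^ ((n + 1) * (n + 1 - 1)) * (b * p ^ k) ^ (n + 1)
      = p ^ ((n + 1) * (n + 1 - 1)) * b ^ (n + 1) * (p ^ k) ^ (n + 1) := by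
        rw [mul_pow, mul_assoc]
    _ ≤ p ^ ((n + 1) * (n + 1 - 1)) * b ^ (n + 1) * p ^ k := by gcongr
    _ = p ^ k * (p ^ ((n + 1) * (n + 1 - 1)) * b ^ (n + 1)) := mul_comm _ _

theorem norm_besselSeries_sub_one_le (hp0 : 0 ≤ p) (hp1 : p < 1) (hb0 : 0 ≤ b) (hb1 : b < 1)
    {R : ℝ} (k : ℕ) {x : ℂ} (hx : ‖x‖ ≤ R) :
    ‖besselSeries p (b * p ^ k) x - 1‖ ≤
      (∑' n, |besselCoeff p b (n + 1)| * R ^ (n + 1)) * p ^ k := by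
  have hp : |p| < 1 := by rwa [abs_of_nonneg hp0]
  rw [besselSeries, (summable_besselSeries hp _ x).tsum_eq_zero_add, besselCoeff_zero,
    Complex.ofReal_one, pow_zero, mul_one, add_sub_cancel_left]
  have hs := (summable_nat_add_iff 1).2 (summable_abs_besselCoeff_mul_pow hp b R)
  refine tsum_of_norm_bounded (hs.hasSum.mul_right (p ^ k)) fun n => ?_
  rw [norm_mul, norm_pow, Complex.norm_real, Real.norm_eq_abs]
  calc |besselCoeff p (b * p ^ k) (n + 1)| * ‖x‖ ^ (n + 1)
      ≤ p ^ k * |besselCoeff p b (n + 1)| * R ^ (n + 1) := by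
        gcongr
        exact abs_besselCoeff_mul_pow_le hp0 hp1 hb0 hb1 k n
    _ = |besselCoeff p b (n + 1)| * R ^ (n + 1) * p ^ k := by ring

theorem tendstoLocallyUniformly_besselSeries (hp0 : 0 ≤ p) (hp1 : p < 1) (hb0 : 0 ≤ b)
    (hb1 : b < 1) :
    TendstoLocallyUniformly (fun k => besselSeries p (b * p ^ k)) (fun _ => 1) atTop := by
  rw [Metric.tendstoLocallyUniformly_iff]
  intro ε hε x
  refine ⟨Metric.closedBall 0 (‖x‖ + 1), Metric.closedBall_mem_nhds_of_mem (by simp), ?_⟩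
  have hlim : Tendsto (fun k => (∑' n, |besselCoeff p b (n + 1)| * (‖x‖ + 1) ^ (n + 1)) * p ^ k)
      atTop (𝓝 0) := by
    simpa using (tendsto_pow_atTop_nhds_zero_of_lt_one hp0 hp1).const_mul _
  filter_upwards [hlim.eventually_lt_const hε] with k hk y hy
  rw [dist_comm, dist_eq_norm]
  exact (norm_besselSeries_sub_one_le hp0 hp1 hb0 hb1 k (mem_closedBall_zero_iff.1 hy)).trans_lt hk

theorem isLommelChain_besselSeries (hp0 : 0 < p) (hp1 : p < 1) (hb0 : 0 < b) (hb1 : b < 1) :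
    IsLommelChain (fun k => b * p ^ k / ((1 - b * p ^ k) * (1 - b * p ^ (k + 1))))
      (fun k => besselSeries p (b * p ^ k)) where
  coeff_pos k := div_pos (mul_pos hb0 (pow_pos hp0 k)) <|
    mul_pos (one_sub_mul_pow_pos hb0.le hb1 hp0.le hp1.le k)
      (one_sub_mul_pow_pos hb0.le hb1 hp0.le hp1.le (k + 1))
  differentiable k := differentiable_besselSeries (by rwa [abs_of_pos hp0]) _
  conj_apply k := conj_besselSeries p _
  recurrence k x := by
    have hne : ∀ n, 1 - b * p ^ k * p ^ n ≠ 0 := fun n => by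
      rw [mul_assoc, ← pow_add]
      exact (one_sub_mul_pow_pos hb0.le hb1 hp0.le hp1.le (k + n)).ne'
    have hp : |p| < 1 := by rwa [abs_of_pos hp0]
    simpa only [mul_assoc, ← pow_succ, ← pow_add] using besselSeries_contiguous hp hne x
  tendsto_one := tendstoLocallyUniformly_besselSeries hp0.le hp1 hb0.le hb1

theorem differentiable_bigE (hq : |q| < 1) : Differentiable ℂ (bigE q) := by
  set c : ℕ → ℂ := fun n => ((q ^ (n * (n - 1) / 2) * (1 - q) ^ n / qPoch q q n : ℝ) : ℂ)
  have hc : ∀ n, c (n + 1) = ((q ^ n * (1 - q) / (1 - q * q ^ n) : ℝ) : ℂ) * c n := fun n => by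
    simp only [c, ← Complex.ofReal_mul]
    rw [qPoch_succ, ← Nat.choose_two_right, ← Nat.choose_two_right, Nat.choose_succ_succ',
      Nat.choose_one_right, pow_add]
    simp only [div_eq_mul_inv, mul_inv]
    ring_nf
  have hratio : Tendsto (fun n : ℕ => ((q ^ n * (1 - q) / (1 - q * q ^ n) : ℝ) : ℂ))
      atTop (𝓝 0) := by
    have hpow := tendsto_pow_atTop_nhds_zero_of_abs_lt_one hq
    have hlim := (hpow.mul_const (1 - q)).div ((hpow.const_mul q).const_sub 1) (by simp)
    exact (Complex.continuous_ofReal.tendsto' 0 0 Complex.ofReal_zero).comp <| by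
      simpa [Pi.div_def] using hlim
  have hE : bigE q = fun z => ∑' n, c n * z ^ n := by
    funext z
    refine tsum_congr fun n => ?_
    simp only [c]
    push_cast
    rw [mul_pow]
    ring
  exact hE ▸ differentiable_tsum_mul_pow_of_ratio_tendsto_zero hratio hc

end BesselSeries

open Complex

section JacksonBessel

variable {α p : ℝ}

theorem exists_isLeast_besselSeries_zero {b : ℝ} (hp0 : 0 < p) (hp1 : p < 1) (hb0 : 0 < b)
    (hb1 : b < 1) :
    ∃ y : ℝ, IsLeast {x : ℝ | 0 < x ∧ besselSeries p b x = 0} y ∧ deriv (besselSeries p b) y ≠ 0 ∧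
      ∃ R > y, ∀ x : ℂ, ‖x‖ < R → besselSeries p b x = 0 → x = y := by
  have h := isLommelChain_besselSeries hp0 hp1 hb0 hb1
  obtain ⟨y, hy⟩ := h.exists_isLeast_zero 0
  have hd := h.deriv_ne_zero hy.1.1 hy.1.2
  have hR := h.exists_forall_norm_lt_eq_of_isLeast hy
  simp only [pow_zero, mul_one] at hy hd hR
  exact ⟨y, hy, hd, hR⟩

theorem modBessel2_eq_besselSeries (α : ℝ) (hp0 : 0 < p) (w : ℂ) :
    modBessel2 α p w = besselSeries p (p ^ (α + 1)) ((w / 2) ^ 2) := by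
  refine tsum_congr fun n => ?_
  have hexp : p ^ ((n : ℝ) * (α + n)) = p ^ (n * (n - 1)) * (p ^ (α + 1)) ^ n := by
    rw [← Real.rpow_natCast, ← Real.rpow_natCast, ← Real.rpow_mul hp0.le, ← Real.rpow_add hp0]
    congr 1
    cases n
    · simp
    · simp only [Nat.add_sub_cancel]
      push_cast
      ring
  rw [hexp, besselCoeff, ← pow_mul]
  push_cast
  ring

theorem modBessel2_neg (α p : ℝ) (w : ℂ) : modBessel2 α p (-w) = modBessel2 α p w := by
  simp only [modBessel2, neg_div, (even_two_mul _).neg_pow]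

theorem deriv_modBessel2_neg (α p : ℝ) (w : ℂ) :
    deriv (modBessel2 α p) (-w) = -deriv (modBessel2 α p) w := by
  rw [← neg_neg (deriv _ (-w)), ← deriv_comp_neg, funext (modBessel2_neg α p)]

theorem hasDerivAt_modBessel2 (α : ℝ) (hp0 : 0 < p) (hp1 : p < 1) (w : ℂ) :
    HasDerivAt (modBessel2 α p)
      (deriv (besselSeries p (p ^ (α + 1))) ((w / 2) ^ 2) * (w / 2)) w := by
  have hd := differentiable_besselSeries (p := p) (by rwa [abs_of_pos hp0]) (p ^ (α + 1))
  have hsq : HasDerivAt (fun w : ℂ => (w / 2) ^ 2) (w / 2) w :=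
    (((hasDerivAt_id' w).div_const 2).pow 2).congr_deriv (by norm_num; ring)
  rw [funext (modBessel2_eq_besselSeries α hp0)]
  exact (hd _).hasDerivAt.comp w hsq

theorem differentiable_modBessel2 (α : ℝ) (hp0 : 0 < p) (hp1 : p < 1) :
    Differentiable ℂ (modBessel2 α p) := fun w =>
  (hasDerivAt_modBessel2 α hp0 hp1 w).differentiableAt

theorem jacksonBessel2_eq_zero_iff (hα : -1 < α) (hp0 : 0 < p) (hp1 : p < 1) {z : ℂ}
    (hz : z ≠ 0) : jacksonBessel2 α p z = 0 ↔ modBessel2 α p z = 0 := by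
  have hb1 : p ^ (α + 1) < 1 := Real.rpow_lt_one hp0.le hp1 (by linarith)
  have hconst : ((qPochInf p p / qPochInf (p ^ (α + 1)) p : ℝ) : ℂ) ≠ 0 :=
    ofReal_ne_zero.2 <| div_ne_zero (qPochInf_ne_zero hp0 hp1 hp0 hp1)
      (qPochInf_ne_zero (Real.rpow_pos_of_pos hp0 _) hb1 hp0 hp1)
  have hpow : (z / 2) ^ (-(α : ℂ)) ≠ 0 := fun h0 =>
    div_ne_zero hz two_ne_zero ((cpow_eq_zero_iff _ _).1 h0).1
  rw [modBessel2_eq hα hp0 hp1 hz, mul_eq_zero, or_iff_right (mul_ne_zero hconst hpow)]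

theorem exists_isLeast_jacksonBessel2_zero (hα : -1 < α) (hp0 : 0 < p) (hp1 : p < 1) :
    ∃ j, IsLeast {x : ℝ | 0 < x ∧ jacksonBessel2 α p x = 0} j ∧ deriv (modBessel2 α p) j ≠ 0 ∧
      ∃ R > j, ∀ w : ℂ, ‖w‖ < R → modBessel2 α p w = 0 → w = j ∨ w = -j := by
  obtain ⟨y, hy, hdy, R, hR, huniq⟩ := exists_isLeast_besselSeries_zero hp0 hp1
    (Real.rpow_pos_of_pos hp0 (α + 1)) (Real.rpow_lt_one hp0.le hp1 (by linarith))
  have hsqrt : 0 < √y := Real.sqrt_pos.2 hy.1.1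
  have hj : (((2 * √y : ℝ) : ℂ) / 2) ^ 2 = y := by
    rw [ofReal_mul, ofReal_ofNat, mul_div_cancel_left₀ _ two_ne_zero, ← ofReal_pow,
      Real.sq_sqrt hy.1.1.le]
  have hzero : ∀ x : ℝ, 0 < x → (jacksonBessel2 α p x = 0 ↔
      besselSeries p (p ^ (α + 1)) (((x / 2) ^ 2 : ℝ) : ℂ) = 0) := fun x hx => by
    rw [jacksonBessel2_eq_zero_iff hα hp0 hp1 (ofReal_ne_zero.2 hx.ne'),
      modBessel2_eq_besselSeries α hp0]
    push_cast
    rfl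
  refine ⟨2 * √y, ⟨⟨by positivity, ?_⟩, fun x ⟨hx, hx0⟩ => ?_⟩, ?_, 2 * √R, ?_, fun w hw hw0 => ?_⟩
  · rw [hzero _ (by positivity), ofReal_pow, ofReal_div, ofReal_ofNat, hj]
    exact hy.1.2
  · have hle := Real.sqrt_le_sqrt (hy.2 ⟨by positivity, (hzero x hx).1 hx0⟩)
    rw [Real.sqrt_sq (by positivity)] at hle
    linarith
  · rw [(hasDerivAt_modBessel2 α hp0 hp1 _).deriv, hj]
    exact mul_ne_zero hdy (div_ne_zero (ofReal_ne_zero.2 (by positivity)) two_ne_zero)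
  · exact mul_lt_mul_of_pos_left (Real.sqrt_lt_sqrt hy.1.1.le hR) two_pos
  · have hnorm : ‖(w / 2) ^ 2‖ < R := by
      rw [norm_pow, norm_div, RCLike.norm_ofNat]
      exact (Real.lt_sqrt (by positivity)).1 (by linarith)
    have hw2 := huniq _ hnorm (modBessel2_eq_besselSeries α hp0 w ▸ hw0)
    rw [← hj, sq_eq_sq_iff_eq_or_eq_neg, ← neg_div] at hw2
    exact hw2.imp (div_left_inj' two_ne_zero).1 (div_left_inj' two_ne_zero).1

end JacksonBessel

section GeneratingFunction

variable {α q : ℝ}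

theorem firstZero_spec (hq0 : 0 < q) (hq1 : q < 1) (hα : -1 < α) :
    IsLeast {x : ℝ | 0 < x ∧ jacksonBessel2 α (q ^ 2) x = 0} (firstZero α q) ∧
      modBesselDeriv α q ≠ 0 ∧ ∃ R > firstZero α q, ∀ w : ℂ, ‖w‖ < R →
        modBessel2 α (q ^ 2) w = 0 → w = firstZero α q ∨ w = -firstZero α q := by
  obtain ⟨j, hj, hspec⟩ :=
    exists_isLeast_jacksonBessel2_zero hα (pow_pos hq0 2) (pow_lt_one₀ hq0.le hq1 two_ne_zero)
  obtain rfl : firstZero α q = j := hj.csInf_eq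
  exact ⟨hj, hspec⟩

theorem bigE_neg_I_mul (q : ℝ) (z : ℂ) : bigE q (-(I * z)) = bigCos q z - I * bigSin q z := by
  unfold bigCos bigSin
  field_simp
  ring

/-- The pole `2iζ` of the generating function; it is nearest to the origin together with its
negative. -/
noncomputable def nearestPole (α q : ℝ) : ℂ := I * (2 * zeta1 α q)

/-- The contribution of the poles `± nearestPole α q` to the `n`-th Taylor coefficient of the
generating function. -/
noncomputable def poleContribution (α q : ℝ) (z : ℂ) (n : ℕ) : ℂ :=
  (bigE q (z * nearestPole α q) * bigE q (-nearestPole α q / 2) +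
      (-1) ^ n * (bigE q (z * -nearestPole α q) * bigE q (- -nearestPole α q / 2))) /
    (I * (1 - q) * modBesselDeriv α q * nearestPole α q ^ (n + 1))

theorem poleContribution_eq (α q : ℝ) (z : ℂ) (n : ℕ) :
    poleContribution α q z n =
      ((bigCos q (2 * zeta1 α q * z) + I * bigSin q (2 * zeta1 α q * z)) *
          (bigCos q (zeta1 α q) - I * bigSin q (zeta1 α q)) +
        (-1) ^ n * ((bigCos q (2 * zeta1 α q * z) - I * bigSin q (2 * zeta1 α q * z)) *
          (bigCos q (zeta1 α q) + I * bigSin q (zeta1 α q)))) /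
      (I * (1 - q) * modBesselDeriv α q * nearestPole α q ^ (n + 1)) := by
  have hz : z * nearestPole α q = I * (2 * zeta1 α q * z) := by
    rw [nearestPole]
    ring
  have hhalf : nearestPole α q / 2 = I * zeta1 α q := by
    rw [nearestPole]
    ring
  rw [poleContribution, mul_neg, neg_neg, neg_div, hz, hhalf, bigE_I_mul, bigE_I_mul,
    bigE_neg_I_mul, bigE_neg_I_mul]

theorem div_neg_one_pow {K : Type*} [Field K] (x : K) (n : ℕ) : x / (-1) ^ n = (-1) ^ n * x := by
  rw [div_eq_mul_inv, ← inv_pow, inv_neg, inv_one, mul_comm]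

theorem poleContribution_two_mul (α q : ℝ) (z : ℂ) (n : ℕ) :
    poleContribution α q z (2 * n) = 2 / (1 - q) * ((-1) ^ (n + 1) *
      (bigCos q (2 * zeta1 α q * z) * bigCos q (zeta1 α q) +
        bigSin q (2 * zeta1 α q * z) * bigSin q (zeta1 α q)) /
      ((2 * zeta1 α q) ^ (2 * n + 1) * modBesselDeriv α q)) := by
  have hI : I * I ^ (2 * n + 1) = (-1) ^ (n + 1) := by
    rw [← pow_succ', show 2 * n + 1 + 1 = 2 * (n + 1) by ring, pow_mul, I_sq]
  have hden : I * (1 - q) * modBesselDeriv α q * nearestPole α q ^ (2 * n + 1) =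
      (1 - q) * (((2 * zeta1 α q) ^ (2 * n + 1) * modBesselDeriv α q) * (-1) ^ (n + 1)) := by
    rw [nearestPole, mul_pow, ← hI]
    ring
  have hnum : ∀ c s c' s' : ℂ, (c + I * s) * (c' - I * s') + (c - I * s) * (c' + I * s') =
      2 * (c * c' + s * s') := fun c s c' s' => by
    linear_combination -2 * s * s' * I_sq
  rw [poleContribution_eq, hden, (even_two_mul n).neg_one_pow, one_mul, hnum,
    ← div_mul_div_comm, ← div_div, div_neg_one_pow, mul_div_assoc]

theorem poleContribution_two_mul_add_one (α q : ℝ) (z : ℂ) (n : ℕ) :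
    poleContribution α q z (2 * n + 1) = 2 / (1 - q) * ((-1) ^ (n + 1) *
      (bigSin q (2 * zeta1 α q * z) * bigCos q (zeta1 α q) -
        bigCos q (2 * zeta1 α q * z) * bigSin q (zeta1 α q)) /
      ((2 * zeta1 α q) ^ (2 * n + 2) * modBesselDeriv α q)) := by
  have hI : I ^ (2 * n + 2) = (-1) ^ (n + 1) := by
    rw [show 2 * n + 2 = 2 * (n + 1) by ring, pow_mul, I_sq]
  have hden : I * (1 - q) * modBesselDeriv α q * nearestPole α q ^ (2 * n + 1 + 1) =
      I * ((1 - q) * (((2 * zeta1 α q) ^ (2 * n + 2) * modBesselDeriv α q) * (-1) ^ (n + 1))) := by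
    rw [nearestPole, mul_pow, ← hI]
    ring
  have hnum : ∀ c s c' s' : ℂ, (c + I * s) * (c' - I * s') - (c - I * s) * (c' + I * s') =
      I * (2 * (s * c' - c * s')) := fun c s c' s' => by
    ring
  rw [poleContribution_eq, hden, (even_two_mul n).add_one.neg_one_pow, neg_one_mul,
    ← sub_eq_add_neg, hnum, mul_div_mul_left _ _ I_ne_zero, ← div_mul_div_comm, ← div_div,
    div_neg_one_pow, mul_div_assoc]

theorem isLittleO_mul_two_mul_add {e : ℕ → ℂ} {r : ℝ}
    (he : e =o[atTop] fun n => (r ^ n)⁻¹) (b : ℕ → ℝ) (i : ℕ) :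
    (fun n => (b (2 * n + i) : ℂ) * e (2 * n + i)) =o[atTop]
      fun n => b (2 * n + i) * (r ^ (2 * n))⁻¹ := by
  have hsub : Tendsto (fun n => 2 * n + i) atTop atTop :=
    tendsto_atTop_mono (fun n => show n ≤ 2 * n + i by lia) tendsto_id
  have hshift : (fun n => (r ^ (2 * n + i))⁻¹) =O[atTop] fun n => (r ^ (2 * n))⁻¹ := by
    refine (isBigO_const_mul_self (r ^ i)⁻¹ _ atTop).congr_left fun n => ?_
    rw [pow_add, mul_inv, mul_comm]
  exact (isBigO_of_le _ fun n => by simp).mul_isLittleO ((he.comp_tendsto hsub).trans_isBigO hshift)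

theorem two_mul_zeta1_mul (α : ℝ) (hq1 : q < 1) : 2 * zeta1 α q * (1 - q) = firstZero α q := by
  have := (sub_pos.2 hq1).ne'
  unfold zeta1
  field_simp

theorem I_mul_nearestPole_mul (α : ℝ) (hq1 : q < 1) :
    I * nearestPole α q * (1 - q) = -firstZero α q := by
  rw [nearestPole, ← mul_assoc, I_mul_I, mul_assoc, neg_one_mul, ← two_mul_zeta1_mul α hq1]
  push_cast
  rfl

theorem zeta1_pos (hq0 : 0 < q) (hq1 : q < 1) (hα : -1 < α) : 0 < zeta1 α q :=
  div_pos (firstZero_spec hq0 hq1 hα).1.1.1 (mul_pos two_pos (sub_pos.2 hq1))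

theorem norm_nearestPole (hζ : 0 ≤ zeta1 α q) : ‖nearestPole α q‖ = 2 * zeta1 α q := by
  rw [nearestPole, norm_mul, norm_I, one_mul, norm_mul, RCLike.norm_ofNat, norm_real,
    Real.norm_of_nonneg hζ]

theorem exists_mem_nearestPoles_iff (hq0 : 0 < q) (hq1 : q < 1) (hα : -1 < α) :
    ∃ R > 2 * zeta1 α q, ∀ t, t ∈ ({nearestPole α q, -nearestPole α q} : Finset ℂ) ↔
      t ∈ Metric.ball 0 R ∧ gFun α q (I * t) = 0 := by
  have hq : 0 < 1 - q := sub_pos.2 hq1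
  have hqc : (1 - q : ℂ) ≠ 0 := by exact_mod_cast hq.ne'
  obtain ⟨⟨⟨hj, hj0⟩, -⟩, -, R, hR, huniq⟩ := firstZero_spec hq0 hq1 hα
  have hzero := (jacksonBessel2_eq_zero_iff hα (pow_pos hq0 2) (pow_lt_one₀ hq0.le hq1 two_ne_zero)
    (ofReal_ne_zero.2 hj.ne')).1 hj0
  have hpole := I_mul_nearestPole_mul α hq1
  have hnorm := norm_nearestPole (zeta1_pos hq0 hq1 hα).le
  have hR' : 2 * zeta1 α q < R / (1 - q) := (lt_div_iff₀ hq).2 (by rwa [two_mul_zeta1_mul α hq1])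
  refine ⟨R / (1 - q), hR', fun t => ?_⟩
  simp only [Finset.mem_insert, Finset.mem_singleton, mem_ball_zero_iff]
  refine ⟨?_, fun ⟨ht, h0⟩ => ?_⟩
  · rintro (rfl | rfl)
    · rw [hnorm, gFun, hpole, modBessel2_neg]
      exact ⟨hR', hzero⟩
    · rw [norm_neg, hnorm, gFun, mul_neg, neg_mul, hpole, neg_neg]
      exact ⟨hR', hzero⟩
  · have htR : ‖I * t * (1 - q)‖ < R := by
      rw [norm_mul, norm_mul, norm_I, one_mul, ← ofReal_one, ← ofReal_sub, norm_real,
        Real.norm_of_nonneg hq.le]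
      exact (lt_div_iff₀ hq).1 ht
    have hw := huniq _ htR h0
    rwa [← neg_neg (firstZero α q : ℂ), ← hpole, neg_neg, ← neg_mul, ← mul_neg, mul_left_inj' hqc,
      mul_left_inj' hqc, mul_right_inj' I_ne_zero, mul_right_inj' I_ne_zero, or_comm] at hw

theorem hasDerivAt_gFun_I_mul (α : ℝ) (hq0 : 0 < q) (hq1 : q < 1) (t : ℂ) :
    HasDerivAt (fun t => gFun α q (I * t))
      (deriv (modBessel2 α (q ^ 2)) (I * t * (1 - q)) * (I * (1 - q))) t := by
  have hd := differentiable_modBessel2 α (pow_pos hq0 2) (pow_lt_one₀ hq0.le hq1 two_ne_zero)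
  have hlin : HasDerivAt (fun t => I * t * (1 - q)) (I * (1 - q)) t := by
    simpa using ((hasDerivAt_id' t).const_mul I).mul_const (1 - q : ℂ)
  exact (hd _).hasDerivAt.comp t hlin

theorem deriv_gFun_I_mul_neg_nearestPole (α : ℝ) (hq0 : 0 < q) (hq1 : q < 1) :
    deriv (fun t => gFun α q (I * t)) (-nearestPole α q) = I * (1 - q) * modBesselDeriv α q := by
  rw [(hasDerivAt_gFun_I_mul α hq0 hq1 _).deriv, mul_neg, neg_mul, I_mul_nearestPole_mul α hq1,
    neg_neg, mul_comm, modBesselDeriv]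

theorem deriv_gFun_I_mul_nearestPole (α : ℝ) (hq0 : 0 < q) (hq1 : q < 1) :
    deriv (fun t => gFun α q (I * t)) (nearestPole α q) =
      -(I * (1 - q) * modBesselDeriv α q) := by
  rw [(hasDerivAt_gFun_I_mul α hq0 hq1 _).deriv, I_mul_nearestPole_mul α hq1,
    deriv_modBessel2_neg, neg_mul, mul_comm, modBesselDeriv]

theorem sum_nearestPoles_eq_neg_poleContribution (hq0 : 0 < q) (hq1 : q < 1)
    (hpole : nearestPole α q ≠ 0) (z : ℂ) (n : ℕ) :
    ∑ s ∈ {nearestPole α q, -nearestPole α q}, bigE q (z * s) * bigE q (-s / 2) /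
      deriv (fun t => gFun α q (I * t)) s / s ^ (n + 1) = -poleContribution α q z n := by
  rw [Finset.sum_pair (self_ne_neg.2 hpole), deriv_gFun_I_mul_nearestPole α hq0 hq1,
    deriv_gFun_I_mul_neg_nearestPole α hq0 hq1, poleContribution, neg_pow (nearestPole α q),
    pow_succ (-1 : ℂ), mul_neg_one, neg_mul, div_neg, div_neg, neg_div, div_div, div_div,
    mul_left_comm, mul_comm ((-1) ^ n) (_ * _), ← div_div _ _ ((-1) ^ n), div_neg_one_pow,
    ← mul_div_assoc, add_div, neg_add]

theorem taylorCoeff_genFun_sub_poleContribution_isLittleO (hq0 : 0 < q) (hq1 : q < 1)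
    (hα : -1 < α) : ∃ R > 2 * zeta1 α q, ∀ (z : ℂ) (r : ℝ), 0 < r → r < R →
      (fun n => taylorCoeff (genFun α q z) n - poleContribution α q z n) =o[atTop]
        fun n => (r ^ n)⁻¹ := by
  have hpole : nearestPole α q ≠ 0 := by
    have hζ := zeta1_pos hq0 hq1 hα
    rw [← norm_pos_iff, norm_nearestPole hζ.le]
    positivity
  have hderiv : I * (1 - q) * modBesselDeriv α q ≠ 0 :=
    mul_ne_zero (mul_ne_zero I_ne_zero (by exact_mod_cast (sub_pos.2 hq1).ne'))
      (firstZero_spec hq0 hq1 hα).2.1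
  have hE := differentiable_bigE (q := q) (by rwa [abs_of_pos hq0])
  have hG : Differentiable ℂ fun t => gFun α q (I * t) := fun t =>
    (hasDerivAt_gFun_I_mul α hq0 hq1 t).differentiableAt
  obtain ⟨R, hR, hS⟩ := exists_mem_nearestPoles_iff hq0 hq1 hα
  refine ⟨R, hR, fun z r hr hrR => ?_⟩
  have hN : Differentiable ℂ fun t => bigE q (z * t) * bigE q (-t / 2) :=
    (hE.comp (by fun_prop)).mul (hE.comp (by fun_prop))
  have hG0 : gFun α q (I * 0) ≠ 0 := fun h0 => by
    have h0S := (hS 0).2 ⟨Metric.mem_ball_self (hr.trans hrR), h0⟩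
    simp [hpole, hpole.symm] at h0S
  have hsimple : ∀ s ∈ ({nearestPole α q, -nearestPole α q} : Finset ℂ),
      deriv (fun t => gFun α q (I * t)) s ≠ 0 := by
    simp only [Finset.mem_insert, Finset.mem_singleton, forall_eq_or_imp, forall_eq,
      deriv_gFun_I_mul_nearestPole α hq0 hq1, deriv_gFun_I_mul_neg_nearestPole α hq0 hq1]
    exact ⟨neg_ne_zero.2 hderiv, hderiv⟩
  refine (taylorCoeff_div_isLittleO hN.differentiableOn hG.differentiableOn hG0 hS hsimple hr
    hrR).congr_left fun n => ?_
  rw [sum_nearestPoles_eq_neg_poleContribution hq0 hq1 hpole, ← sub_eq_add_neg]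
  rfl

end GeneratingFunction

end QBernoulli

open QBernoulli Filter Asymptotics in
theorem theorem3p1_general (q α : ℝ) (hq0 : 0 < q) (hq1 : q < 1) (hα : -1 < α) :
    IsLeast {x : ℝ | 0 < x ∧ jacksonBessel2 α (q ^ 2) (x : ℂ) = 0} (firstZero α q) ∧
    modBesselDeriv α q ≠ 0 ∧
    ∃ R > 2 * zeta1 α q, ∀ (z : ℂ) (r : ℝ), 0 < r → r < R →
      ((fun n : ℕ => qBernoulli2 α q (2 * n) z -
          2 / (1 - (q : ℂ)) *
            ((-1) ^ (n + 1) * (qFact q (2 * n) : ℂ) *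
              (bigCos q (2 * (zeta1 α q : ℂ) * z) * bigCos q (zeta1 α q : ℂ) +
                bigSin q (2 * (zeta1 α q : ℂ) * z) * bigSin q (zeta1 α q : ℂ)) /
              ((2 * (zeta1 α q : ℂ)) ^ (2 * n + 1) * modBesselDeriv α q)))
        =o[atTop] (fun n : ℕ => qFact q (2 * n) * (r ^ (2 * n))⁻¹)) ∧
      ((fun n : ℕ => qBernoulli2 α q (2 * n + 1) z -
          2 / (1 - (q : ℂ)) *
            ((-1) ^ (n + 1) * (qFact q (2 * n + 1) : ℂ) *
              (bigSin q (2 * (zeta1 α q : ℂ) * z) * bigCos q (zeta1 α q : ℂ) -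
                bigCos q (2 * (zeta1 α q : ℂ) * z) * bigSin q (zeta1 α q : ℂ)) /
              ((2 * (zeta1 α q : ℂ)) ^ (2 * n + 2) * modBesselDeriv α q)))
        =o[atTop] (fun n : ℕ => qFact q (2 * n + 1) * (r ^ (2 * n))⁻¹)) := by
  obtain ⟨hj, hD, -⟩ := firstZero_spec hq0 hq1 hα
  obtain ⟨R, hR, hcoeff⟩ := taylorCoeff_genFun_sub_poleContribution_isLittleO hq0 hq1 hα
  refine ⟨hj, hD, R, hR, fun z r hr hrR => ⟨?_, ?_⟩⟩
  · refine (isLittleO_mul_two_mul_add (hcoeff z r hr hrR) (qFact q) 0).congr_left fun n => ?_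
    rw [add_zero, poleContribution_two_mul, qBernoulli2, taylorCoeff]
    ring
  · refine (isLittleO_mul_two_mul_add (hcoeff z r hr hrR) (qFact q) 1).congr_left fun n => ?_
    rw [poleContribution_two_mul_add_one, qBernoulli2, taylorCoeff]
    ring

open QBernoulli Filter Asymptotics in
theorem theorem3p1 (q α : ℝ) (hq0 : 0 < q) (hq1 : q < 1) (hα : -1 < α) :
    IsLeast {x : ℝ | 0 < x ∧ jacksonBessel2 α (q ^ 2) (x : ℂ) = 0} (firstZero α q) ∧
    modBesselDeriv α q ≠ 0 ∧
    ∀ (z : ℂ) (r : ℝ), 0 < r → r ≤ 2 * zeta1 α q →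
      ((fun n : ℕ => qBernoulli2 α q (2 * n) z -
          2 / (1 - (q : ℂ)) *
            ((-1) ^ (n + 1) * (qFact q (2 * n) : ℂ) *
              (bigCos q (2 * (zeta1 α q : ℂ) * z) * bigCos q (zeta1 α q : ℂ) +
                bigSin q (2 * (zeta1 α q : ℂ) * z) * bigSin q (zeta1 α q : ℂ)) /
              ((2 * (zeta1 α q : ℂ)) ^ (2 * n + 1) * modBesselDeriv α q)))
        =o[atTop] (fun n : ℕ => qFact q (2 * n) * (r ^ (2 * n))⁻¹)) ∧
      ((fun n : ℕ => qBernoulli2 α q (2 * n + 1) z -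
          2 / (1 - (q : ℂ)) *
            ((-1) ^ (n + 1) * (qFact q (2 * n + 1) : ℂ) *
              (bigSin q (2 * (zeta1 α q : ℂ) * z) * bigCos q (zeta1 α q : ℂ) -
                bigCos q (2 * (zeta1 α q : ℂ) * z) * bigSin q (zeta1 α q : ℂ)) /
              ((2 * (zeta1 α q : ℂ)) ^ (2 * n + 2) * modBesselDeriv α q)))
        =o[atTop] (fun n : ℕ => qFact q (2 * n + 1) * (r ^ (2 * n))⁻¹)) := by
  obtain ⟨hj, hD, R, hR, hasymp⟩ := theorem3p1_general q α hq0 hq1 hα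
  exact ⟨hj, hD, fun z r hr hrζ => hasymp z r hr (hrζ.trans_lt hR)⟩
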